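/- For a partition $\lambda$ of a non-negative integer $n$, let its rank be its largest part minus its number of parts. Let its crank be its largest part if $\lambda$ has no part equal to $1$, and otherwise $\mu(\lambda)-\omega(\lambda)$, where $\omega(\lambda)$ is the number of ones in $\lambda$ and $\mu(\lambda)$ is the number of parts of $\lambda$ larger than $\omega(\lambda)$. (The empty partition of $0$ has rank and crank $0$.) Let $p(m,n)$ be the number of partitions of $n$ with exactly $m$ parts, let $N(m,n)$ be the number of partitions of $n$ with rank $m$, and for $n\neq 1$ let $M(m,n)$ be the number of partitions of $n$ with crank $m$; for $n=1$ put, as usual, $M(-1,1)=M(1,1)=1$, $M(0,1)=-1$ and $M(m,1)=0$ for all other $m$. Put $$p_2(n)=\sum_{m\ge 0}m^2p(m,n),\qquad N_2(n)=\sum_{m\in\mathbb Z}m^2N(m,n),\qquad M_2(n)=\sum_{m\in\mathbb Z}m^2M(m,n).$$ Then, for every integer $n\ge 0$, $$M_2(n)+N_2(n)\le 2p_2(n).$$ -/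

import Mathlib

namespace PartitionMoments

/-- The largest part of a partition (`0` for the empty partition). -/
def largestPart {n : ℕ} (lam : n.Partition) : ℕ := lam.parts.sup

/-- The number of parts of a partition. -/
def numParts {n : ℕ} (lam : n.Partition) : ℕ := Multiset.card lam.parts

/-- The number of parts of a partition that are equal to `1`. -/
def numOnes {n : ℕ} (lam : n.Partition) : ℕ := lam.parts.count 1

/-- The number of parts of a partition that are larger than its number of ones. -/
def numPartsAboveOnes {n : ℕ} (lam : n.Partition) : ℕ :=
  Multiset.card (lam.parts.filter (fun i => numOnes lam < i))

/-- Dyson's rank of a partition: the largest part minus the number of parts. -/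
def rank {n : ℕ} (lam : n.Partition) : ℤ := (largestPart lam : ℤ) - (numParts lam : ℤ)

/-- The Andrews--Garvan crank of a partition: the largest part if there are no ones, and otherwise
the number of parts larger than the number of ones, minus the number of ones. -/
def crank {n : ℕ} (lam : n.Partition) : ℤ :=
  if numOnes lam = 0 then (largestPart lam : ℤ)
  else (numPartsAboveOnes lam : ℤ) - (numOnes lam : ℤ)

/-- `p(m, n)`: the number of partitions of `n` with exactly `m` parts. -/
def partsCount (m n : ℕ) : ℕ :=
  (Finset.univ.filter (fun lam : n.Partition => numParts lam = m)).card

/-- `N(m, n)`: the number of partitions of `n` with rank `m`. -/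
def rankCount (m : ℤ) (n : ℕ) : ℤ :=
  ((Finset.univ.filter (fun lam : n.Partition => rank lam = m)).card : ℤ)

/-- `M(m, n)`: for `n ≠ 1` the number of partitions of `n` with crank `m`, and for `n = 1` the
usual convention `M(-1, 1) = M(1, 1) = 1`, `M(0, 1) = -1` and `M(m, 1) = 0` for all other `m`. -/
def crankCount (m : ℤ) (n : ℕ) : ℤ :=
  if n = 1 then (if m = 0 then -1 else if m = 1 ∨ m = -1 then 1 else 0)
  else ((Finset.univ.filter (fun lam : n.Partition => crank lam = m)).card : ℤ)

/-- `p₂(n) = ∑ₘ m² p(m, n)`. The sum has finite support, see `finite_support_partsCount`. -/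
noncomputable def p2 (n : ℕ) : ℕ := ∑ᶠ m : ℕ, m ^ 2 * partsCount m n

/-- The second rank moment `N₂(n) = ∑ₘ m² N(m, n)`, over all integers `m`. The sum has finite
support, see `finite_support_rankCount`. -/
noncomputable def N2 (n : ℕ) : ℤ := ∑ᶠ m : ℤ, m ^ 2 * rankCount m n

/-- The second crank moment `M₂(n) = ∑ₘ m² M(m, n)`, over all integers `m`. The sum has finite
support, see `finite_support_crankCount`. -/
noncomputable def M2 (n : ℕ) : ℤ := ∑ᶠ m : ℤ, m ^ 2 * crankCount m n

theorem finite_support_partsCount (n : ℕ) :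
    (Function.support (fun m : ℕ => m ^ 2 * partsCount m n)).Finite := by
  refine (Set.finite_range (fun lam : n.Partition => numParts lam)).subset ?_
  intro m hm
  by_contra h
  apply hm
  have h0 : partsCount m n = 0 := by
    unfold partsCount
    rw [Finset.card_eq_zero, Finset.filter_eq_empty_iff]
    exact fun lam _ hl => h ⟨lam, hl⟩
  simp [h0]

theorem finite_support_rankCount (n : ℕ) :
    (Function.support (fun m : ℤ => m ^ 2 * rankCount m n)).Finite := by
  refine (Set.finite_range (fun lam : n.Partition => rank lam)).subset ?_
  intro m hm
  by_contra h
  apply hm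
  have h0 : rankCount m n = 0 := by
    unfold rankCount
    rw [Nat.cast_eq_zero, Finset.card_eq_zero, Finset.filter_eq_empty_iff]
    exact fun lam _ hl => h ⟨lam, hl⟩
  simp [h0]

theorem finite_support_crankCount (n : ℕ) :
    (Function.support (fun m : ℤ => m ^ 2 * crankCount m n)).Finite := by
  refine ((Set.finite_range (fun lam : n.Partition => crank lam)).union
    (Set.toFinite {1, -1})).subset ?_
  intro m hm
  by_contra h
  simp only [Set.mem_union, Set.mem_range, Set.mem_insert_iff, Set.mem_singleton_iff,
    not_or, not_exists] at h
  apply hm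
  by_cases hn : n = 1
  · by_cases hm0 : m = 0
    · simp [hm0]
    · simp [crankCount, hn, hm0, h.2.1, h.2.2]
  · have h0 : crankCount m n = 0 := by
      unfold crankCount
      rw [if_neg hn, Nat.cast_eq_zero, Finset.card_eq_zero, Finset.filter_eq_empty_iff]
      exact fun lam _ => h.1 lam
    simp [h0]

end PartitionMoments

/-! Write ℓ for the largest part and k for the number of parts. Since ℓ and k are equidistributed
(`sum_pow_sup_eq_sum_pow_card`), expanding (ℓ - k)² gives N₂(n) = 2p₂(n) - 2∑ℓk. A partition of n
fits in an ℓ by k rectangle, so ℓk ≥ n and N₂(n) ≤ 2p₂(n) - 2n p(n). Dyson's identity M₂(n) = 2n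
p(n) (`M2_eq`) finishes the proof.

Dyson's identity comes from the crank product ∏ (1 - qⁱ) / ((1 - zqⁱ)(1 - wqⁱ)), zw = 1
(`modX_crank_product`), itself an instance of the q-binomial theorem. If σ = z + w - 2 has square
zero, then (1 - zx)(1 - wx) = (1 - x)²(1 - σx/(1 - x)²), so the product is P(1 + σ∑ qⁱ/(1 - qⁱ)²)
with P = ∑ p(n)qⁿ, and P∑ qⁱ/(1 - qⁱ)² = ∑ n p(n)qⁿ (`sum_crankWeight`). Doubly dual numbers supply
z and w for which the ε₁ε₂-coefficient of the crank series is the second moment. -/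

namespace PartitionMoments

open PowerSeries

/-! ### Generating series over partitions and Euler products -/

section Series

variable {R : Type*} [CommRing R]

/-- The generating series `∑ₙ (∑_{λ ⊢ n} F λ) Xⁿ` of a function `F` of the multiset of parts. -/
noncomputable def partSeries (F : Multiset ℕ → R) : R⟦X⟧ :=
  PowerSeries.mk fun n => ∑ lam : n.Partition, F lam.parts

/-- The multiplicative weight `∏ v i` over the parts `i`. -/
def weight (v : ℕ → R) (m : Multiset ℕ) : R := (m.map v).prod

@[simp] lemma weight_cons (v : ℕ → R) (a : ℕ) (m : Multiset ℕ) :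
    weight v (a ::ₘ m) = v a * weight v m := by
  simp [weight]

lemma coeff_partSeries (F : Multiset ℕ → R) (n : ℕ) :
    coeff n (partSeries F) = ∑ lam : n.Partition, F lam.parts := by
  simp [partSeries]

lemma partSeries_add (F G : Multiset ℕ → R) :
    partSeries (fun m => F m + G m) = partSeries F + partSeries G := by
  ext n
  simp [coeff_partSeries, Finset.sum_add_distrib]

lemma partSeries_const_mul (c : R) (F : Multiset ℕ → R) :
    partSeries (fun m => c * F m) = C c * partSeries F := by
  ext n
  simp [coeff_partSeries, Finset.mul_sum]

lemma partSeries_zero : partSeries (fun _ => (0 : R)) = 0 := by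
  ext n
  simp [coeff_partSeries]

lemma partSeries_sum {ι : Type*} (s : Finset ι) (F : ι → Multiset ℕ → R) :
    partSeries (fun m => ∑ i ∈ s, F i m) = ∑ i ∈ s, partSeries (F i) := by
  ext n
  simp only [coeff_partSeries, map_sum]
  exact Finset.sum_comm

lemma partSeries_congr {F G : Multiset ℕ → R}
    (h : ∀ (n : ℕ) (lam : n.Partition), F lam.parts = G lam.parts) :
    partSeries F = partSeries G := by
  ext n
  simp [coeff_partSeries, h]

lemma weight_congr {n : ℕ} (lam : n.Partition) {u v : ℕ → R} (h : ∀ i, 1 ≤ i → u i = v i) :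
    weight u lam.parts = weight v lam.parts := by
  unfold weight
  congr 1
  exact Multiset.map_congr rfl fun i hi => h i (lam.parts_pos hi)

lemma sum_filter_mem_parts (F : Multiset ℕ → R) {a n : ℕ} (ha : 1 ≤ a) (han : a ≤ n) :
    ∑ lam : n.Partition with a ∈ lam.parts, F lam.parts
      = ∑ mu : (n - a).Partition, F (a ::ₘ mu.parts) := by
  rw [Finset.sum_subtype (p := fun lam : n.Partition => a ∈ lam.parts) _ (by simp)]
  refine Fintype.sum_equiv (Nat.Partition.partitionWithPartEquiv ha han) _ _ fun lam => ?_
  rw [Nat.Partition.partitionWithPartEquiv_apply_parts, Multiset.cons_erase lam.2]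

/-- Splitting the partitions according to whether `a` is a part. -/
lemma partSeries_remove (F : Multiset ℕ → R) {a : ℕ} (ha : 1 ≤ a) :
    partSeries F = partSeries (fun m => if a ∈ m then 0 else F m)
      + X ^ a * partSeries (fun m => F (a ::ₘ m)) := by
  ext n
  rw [map_add, coeff_X_pow_mul', coeff_partSeries, coeff_partSeries,
    ← Finset.sum_filter_add_sum_filter_not _ (fun lam : n.Partition => a ∈ lam.parts), add_comm]
  congr 1
  · rw [Finset.sum_filter]
    exact Finset.sum_congr rfl fun lam _ => by split_ifs <;> simp_all
  · split_ifs with h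
    · rw [coeff_partSeries, sum_filter_mem_parts F ha h]
    · rw [Finset.filter_false_of_mem, Finset.sum_empty]
      exact fun lam _ hm => h (lam.le_of_mem_parts hm)

lemma weight_eq_zero {v : ℕ → R} {a : ℕ} {m : Multiset ℕ} (h : a ∈ m) (hv : v a = 0) :
    weight v m = 0 :=
  Multiset.prod_eq_zero (Multiset.mem_map.2 ⟨a, h, hv⟩)

lemma weight_update (v : ℕ → R) (a : ℕ) (m : Multiset ℕ) :
    weight (Function.update v a 0) m = if a ∈ m then 0 else weight v m := by
  split_ifs with hm
  · rw [weight_eq_zero hm (by simp)]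
  · unfold weight
    congr 1
    refine Multiset.map_congr rfl fun i hi => ?_
    rw [Function.update_of_ne]
    rintro rfl
    exact hm hi

/-- Deleting one copy of `a` is a bijection from partitions containing `a`, so forbidding the part
`a` cancels exactly one Euler factor. -/
lemma partSeries_weight_update (v : ℕ → R) {a : ℕ} (ha : 1 ≤ a) :
    partSeries (weight v) * (1 - C (v a) * X ^ a) =
      partSeries (weight (Function.update v a 0)) := by
  have h := partSeries_remove (weight v) ha
  have h1 : (fun m => if a ∈ m then 0 else weight v m) = weight (Function.update v a 0) :=
    funext fun m => (weight_update v a m).symm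
  have h2 : (fun m => weight v (a ::ₘ m)) = fun m => v a * weight v m := by
    funext m
    simp
  rw [h1, h2, partSeries_const_mul] at h
  linear_combination h

/-- Two series of parts agree modulo `X ^ (N + 1)` if the functions agree on all partitions of
numbers up to `N`. -/
lemma mk_partSeries_congr {N : ℕ} {F G : Multiset ℕ → R}
    (h : ∀ n ≤ N, ∀ lam : n.Partition, F lam.parts = G lam.parts) :
    Ideal.Quotient.mk (Ideal.span {(X : R⟦X⟧) ^ (N + 1)}) (partSeries F)
      = Ideal.Quotient.mk (Ideal.span {(X : R⟦X⟧) ^ (N + 1)}) (partSeries G) := by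
  rw [Ideal.Quotient.eq, Ideal.mem_span_singleton, X_pow_dvd_iff]
  intro n hn
  rw [map_sub, coeff_partSeries, coeff_partSeries, sub_eq_zero]
  exact Finset.sum_congr rfl fun lam _ => h n (by omega) lam

/-- Working modulo `X ^ (N + 1)` keeps all sums and products finite; this recovers the coefficients.
-/
lemma coeff_eq_of_mk_eq {N : ℕ} {f g : R⟦X⟧}
    (h : Ideal.Quotient.mk (Ideal.span {(X : R⟦X⟧) ^ (N + 1)}) f
      = Ideal.Quotient.mk (Ideal.span {(X : R⟦X⟧) ^ (N + 1)}) g) {n : ℕ} (hn : n ≤ N) :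
    coeff n f = coeff n g := by
  rw [Ideal.Quotient.eq, Ideal.mem_span_singleton, X_pow_dvd_iff] at h
  have := h n (by omega)
  rwa [map_sub, sub_eq_zero] at this

lemma partSeries_weight_prod (v : ℕ → R) (N : ℕ) :
    partSeries (weight v) * ∏ i ∈ Finset.range N, (1 - C (v (i + 1)) * X ^ (i + 1))
      = partSeries (weight (fun i => if i ≤ N then 0 else v i)) := by
  induction N with
  | zero =>
    simp only [Finset.range_zero, Finset.prod_empty, mul_one]
    exact partSeries_congr fun n lam => weight_congr lam fun i hi => by
      rw [if_neg (by omega)]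
  | succ N ih =>
    rw [Finset.prod_range_succ, ← mul_assoc, ih]
    have := partSeries_weight_update (fun i => if i ≤ N then 0 else v i) (a := N + 1) (by omega)
    simp only [Nat.not_succ_le_self, if_false] at this
    rw [this]
    congr 2
    funext i
    rcases lt_trichotomy i (N + 1) with h | rfl | h
    · rw [Function.update_of_ne h.ne, if_pos (by omega), if_pos (by omega)]
    · simp
    · rw [Function.update_of_ne h.ne', if_neg (by omega), if_neg (by omega)]

lemma partSeries_weight_one : partSeries (fun m => if m = 0 then (1 : R) else 0) = 1 := by
  ext n
  rw [coeff_partSeries, coeff_one]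
  split_ifs with h
  · subst h
    simp
  · refine Finset.sum_eq_zero fun lam _ => if_neg fun h0 => h ?_
    rw [← lam.parts_sum, h0, Multiset.sum_zero]

lemma weight_eq_ite {n : ℕ} (lam : n.Partition) {v : ℕ → R}
    (hv : ∀ i, 1 ≤ i → i ≤ n → v i = 0) :
    weight v lam.parts = if lam.parts = 0 then 1 else 0 := by
  split_ifs with h
  · simp [h, weight]
  · obtain ⟨a, ha⟩ := Multiset.exists_mem_of_ne_zero h
    exact weight_eq_zero ha (hv a (lam.parts_pos ha) (lam.le_of_mem_parts ha))

/-- Euler's product for multiplicative weights, modulo `X ^ (N + 1)`. -/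
lemma mk_partSeries_weight_prod (v : ℕ → R) (N : ℕ) :
    Ideal.Quotient.mk (Ideal.span {(X : R⟦X⟧) ^ (N + 1)})
      (partSeries (weight v) * ∏ i ∈ Finset.range N, (1 - C (v (i + 1)) * X ^ (i + 1))) = 1 := by
  rw [partSeries_weight_prod, ← map_one (Ideal.Quotient.mk _), ← partSeries_weight_one]
  exact mk_partSeries_congr fun n hn lam => weight_eq_ite lam fun i _ h2 => if_pos (by omega)

end Series

/-! ### The q-binomial theorem -/

section QBinomial

variable {S : Type*} [CommRing S]

/-- The `q`-binomial theorem for a nilpotent `q`. -/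
lemma qbinomial {N : ℕ} {q : S} (hq : q ^ (N + 1) = 0) (a y : S) (c : ℕ → S) (c0 : c 0 = 1)
    (hc : ∀ j, c (j + 1) * (1 - q ^ (j + 1)) = c j * (1 - a * q ^ j)) :
    (∏ i ∈ Finset.range N, (1 - y * q ^ (i + 1))) * ∑ j ∈ Finset.range (N + 1), c j * (y * q) ^ j
      = ∏ i ∈ Finset.range N, (1 - a * y * q ^ (i + 1)) := by
  let F : S → S := fun x => ∑ j ∈ Finset.range (N + 1), c j * x ^ j
  -- The usual functional equation; truncating `F` costs only a term in `x ^ (N + 1)`, which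
  -- vanishes. Iterating it pushes the argument to `y * q ^ (N + 1) = 0`.
  have step : ∀ x, x ^ (N + 1) = 0 → (1 - x) * F x = (1 - a * x) * F (q * x) := by
    intro x hx
    have e1 : F x - F (q * x) = ∑ j ∈ Finset.range (N + 1), c j * (1 - q ^ j) * x ^ j := by
      simp only [F, ← Finset.sum_sub_distrib]
      exact Finset.sum_congr rfl fun j _ => by ring
    have e2 : x * F x - a * x * F (q * x)
        = ∑ j ∈ Finset.range (N + 1), c j * (1 - a * q ^ j) * x ^ (j + 1) := by
      simp only [F, Finset.mul_sum, ← Finset.sum_sub_distrib]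
      exact Finset.sum_congr rfl fun j _ => by ring
    rw [Finset.sum_range_succ'] at e1
    rw [Finset.sum_range_succ, hx] at e2
    have e3 : ∑ j ∈ Finset.range N, c (j + 1) * (1 - q ^ (j + 1)) * x ^ (j + 1)
        = ∑ j ∈ Finset.range N, c j * (1 - a * q ^ j) * x ^ (j + 1) :=
      Finset.sum_congr rfl fun j _ => by rw [hc]
    rw [e3] at e1
    simp only [pow_zero, sub_self, mul_zero, zero_mul, add_zero] at e1 e2
    linear_combination e1 - e2
  have iter : ∀ K, (∏ i ∈ Finset.range K, (1 - y * q ^ (i + 1))) * F (y * q)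
      = (∏ i ∈ Finset.range K, (1 - a * y * q ^ (i + 1))) * F (y * q ^ (K + 1)) := by
    intro K
    induction K with
    | zero => simp
    | succ K ih =>
      rw [Finset.prod_range_succ, Finset.prod_range_succ, mul_right_comm, ih]
      have := step (y * q ^ (K + 1)) (by
        rw [mul_pow, ← pow_mul, mul_comm (K + 1), pow_mul, hq, zero_pow (by omega), mul_zero])
      rw [show q * (y * q ^ (K + 1)) = y * q ^ (K + 1 + 1) by ring] at this
      linear_combination (∏ i ∈ Finset.range K, (1 - a * y * q ^ (i + 1))) * this
  have := iter N
  rw [hq, mul_zero] at this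
  have F0 : F 0 = 1 := by
    simp only [F]
    rw [Finset.sum_range_succ']
    simp [c0]
  rw [F0, mul_one] at this
  exact this

end QBinomial

/-! ### Largest part, number of parts, and the crank product -/

section Truncated

variable {R : Type*} [CommRing R]

/-- Reduction of power series modulo `X ^ (N + 1)`. -/
noncomputable abbrev modX (R : Type*) [CommRing R] (N : ℕ) :
    R⟦X⟧ →+* R⟦X⟧ ⧸ Ideal.span {(X : R⟦X⟧) ^ (N + 1)} :=
  Ideal.Quotient.mk _

lemma modX_X_pow (N : ℕ) : (modX R N X) ^ (N + 1) = 0 := by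
  rw [← map_pow, Ideal.Quotient.eq_zero_iff_mem]
  exact Ideal.mem_span_singleton_self _

lemma weight_le (u : ℕ → R) (L : ℕ) (m : Multiset ℕ) :
    weight (fun i => if i ≤ L then u i else 0) m = if m.sup ≤ L then weight u m else 0 := by
  split_ifs with h
  · rw [Multiset.sup_le] at h
    unfold weight
    congr 1
    exact Multiset.map_congr rfl fun i hi => if_pos (h i hi)
  · rw [Multiset.sup_le] at h
    push Not at h
    obtain ⟨b, hb, hb'⟩ := h
    exact weight_eq_zero hb (if_neg (by omega))

lemma partSeries_weight_le_succ (u : ℕ → R) (L : ℕ) :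
    partSeries (weight (fun i => if i ≤ L + 1 then u i else 0)) * (1 - C (u (L + 1)) * X ^ (L + 1))
      = partSeries (weight (fun i => if i ≤ L then u i else 0)) := by
  have := partSeries_weight_update (fun i => if i ≤ L + 1 then u i else 0) (a := L + 1) (by omega)
  simp only [le_refl, if_true] at this
  rw [this]
  congr 2
  funext i
  rcases lt_trichotomy i (L + 1) with h | rfl | h
  · rw [Function.update_of_ne h.ne, if_pos (by omega), if_pos (by omega)]
  · simp
  · rw [Function.update_of_ne h.ne', if_neg (by omega), if_neg (by omega)]

/-- Partitions with largest part `L + 1`. -/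
lemma partSeries_sup_eq (u : ℕ → R) (L : ℕ) :
    partSeries (fun m => if m.sup = L + 1 then weight u m else 0)
      = C (u (L + 1)) * X ^ (L + 1)
        * partSeries (weight (fun i => if i ≤ L + 1 then u i else 0)) := by
  have h : partSeries (weight (fun i => if i ≤ L + 1 then u i else 0))
      = partSeries (fun m => if m.sup = L + 1 then weight u m else 0)
        + partSeries (weight (fun i => if i ≤ L then u i else 0)) := by
    rw [← partSeries_add]
    congr 1
    funext m
    rw [weight_le, weight_le]
    split_ifs <;> first | omega | simp
  rw [← partSeries_weight_le_succ u L] at h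
  linear_combination -h

lemma parts_sup_le {n : ℕ} (lam : n.Partition) : lam.parts.sup ≤ n :=
  Multiset.sup_le.2 fun _ hb => lam.le_of_mem_parts hb

lemma parts_sup_eq_zero {n : ℕ} (lam : n.Partition) : lam.parts.sup = 0 ↔ lam.parts = 0 := by
  refine ⟨fun h => ?_, fun h => by simp [h]⟩
  by_contra h0
  obtain ⟨a, ha⟩ := Multiset.exists_mem_of_ne_zero h0
  have := Multiset.le_sup ha
  have := lam.parts_pos ha
  omega

/-- The generating series by largest part. -/
lemma modX_partSeries_sup (N : ℕ) (z : R) (u : ℕ → R) :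
    modX R N (partSeries (fun m => z ^ m.sup * weight u m))
      = 1 + ∑ L ∈ Finset.range N, modX R N (C z * X) ^ (L + 1) * modX R N (C (u (L + 1)))
        * modX R N (partSeries (weight (fun i => if i ≤ L + 1 then u i else 0))) := by
  have h : modX R N (partSeries (fun m => z ^ m.sup * weight u m))
      = modX R N (partSeries (fun m => (if m = 0 then 1 else 0) + ∑ L ∈ Finset.range N,
          z ^ (L + 1) * if m.sup = L + 1 then weight u m else 0)) := by
    refine mk_partSeries_congr fun n hn lam => ?_
    have hs := parts_sup_le lam
    by_cases h0 : lam.parts = 0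
    · simp [h0, weight]
    · have h1 := mt (parts_sup_eq_zero lam).1 h0
      rw [if_neg h0, zero_add, Finset.sum_eq_single (lam.parts.sup - 1)]
      · rw [Nat.sub_add_cancel (by omega), if_pos rfl]
      · intro b _ hb
        rw [if_neg (by omega), mul_zero]
      · intro hb
        rw [Finset.mem_range] at hb
        omega
  rw [h, partSeries_add, partSeries_weight_one, partSeries_sum, map_add, map_one, map_sum]
  congr 1
  refine Finset.sum_congr rfl fun L _ => ?_
  rw [partSeries_const_mul, partSeries_sup_eq]
  simp only [map_mul, map_pow]
  ring

lemma partSeries_weight_le_zero (u : ℕ → R) :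
    partSeries (weight (fun i => if i ≤ 0 then u i else 0)) = 1 := by
  rw [← partSeries_weight_one]
  exact partSeries_congr fun n lam => weight_eq_ite lam fun i h _ => if_neg (by omega)

lemma modX_partSeries_weight_prod (v : ℕ → R) (N : ℕ) :
    modX R N (partSeries (weight v))
      * ∏ i ∈ Finset.range N, (1 - modX R N (C (v (i + 1))) * modX R N X ^ (i + 1)) = 1 := by
  have := mk_partSeries_weight_prod v N
  simpa only [map_mul, map_prod, map_sub, map_one, map_pow] using this

/-- Euler's expansion of `1 / ∏ (1 - z qⁱ)`. -/
lemma modX_euler (N : ℕ) (z : R) :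
    ∑ L ∈ Finset.range (N + 1), modX R N (C z * X) ^ L
        * modX R N (partSeries (weight (fun i => if i ≤ L then 1 else 0)))
      = modX R N (partSeries (weight fun _ => z)) := by
  -- With `a = 0` the coefficients satisfy c_{j+1}(1 - q^{j+1}) = c_j, i.e. they are 1/((1 - q)⋯(1 -
  -- qʲ)).
  have h1 := qbinomial (modX_X_pow (R := R) N) 0 (modX R N (C z))
    (fun L => modX R N (partSeries (weight (fun i => if i ≤ L then 1 else 0))))
    (by rw [partSeries_weight_le_zero, map_one])
    (fun L => by
      rw [zero_mul, sub_zero, mul_one, ← partSeries_weight_le_succ _ L]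
      simp only [map_mul, map_sub, map_one, map_pow, one_mul])
  simp only [zero_mul, sub_zero, Finset.prod_const_one] at h1
  have h2 := modX_partSeries_weight_prod (fun _ => z) N
  rw [← mul_one (modX R N (partSeries (weight fun _ => z))), ← h1, ← mul_assoc, h2, one_mul]
  exact Finset.sum_congr rfl fun L _ => by rw [map_mul, mul_comm]

/-- The largest part and the number of parts are equidistributed. -/
lemma sum_pow_sup_eq_sum_pow_card (n : ℕ) (z : R) :
    ∑ lam : n.Partition, z ^ lam.parts.sup = ∑ lam : n.Partition, z ^ lam.parts.card := by
  have h := modX_partSeries_sup n z (fun _ => 1)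
  have h2 := modX_euler n z
  rw [Finset.sum_range_succ', partSeries_weight_le_zero, map_one, pow_zero, one_mul,
    add_comm _ (1 : R⟦X⟧ ⧸ _)] at h2
  simp only [map_one, mul_one] at h
  rw [h2] at h
  have := coeff_eq_of_mk_eq h le_rfl
  simpa [coeff_partSeries, weight] using this

lemma weight_ite_le (z : R) (j : ℕ) (m : Multiset ℕ) :
    weight (fun k => if k ≤ j then 1 else z) m = z ^ (m.filter (j < ·)).card := by
  induction m using Multiset.induction with
  | empty => simp [weight]
  | cons a m ih =>
    rw [weight_cons, ih]
    split_ifs with h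
    · rw [Multiset.filter_cons_of_neg _ (by omega), one_mul]
    · rw [Multiset.filter_cons_of_pos _ (by omega), Multiset.card_cons, pow_succ, mul_comm]

/-- Partitions with exactly `i` ones, weighted by the parts larger than `j`. -/
lemma partSeries_count_one (z : R) {i j : ℕ} (hj : 1 ≤ j) :
    partSeries (fun m => if m.count 1 = i then z ^ (m.filter (j < ·)).card else 0)
      = X ^ i * (partSeries (weight (fun k => if k ≤ j then 1 else z)) * (1 - X)) := by
  induction i with
  | zero =>
    have := partSeries_weight_update (fun k => if k ≤ j then 1 else z) le_rfl
    simp only [hj, if_true, map_one, one_mul, pow_one] at this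
    rw [this, pow_zero, one_mul]
    congr 1
    funext m
    rw [weight_update, weight_ite_le]
    simp only [Multiset.count_eq_zero]
    split_ifs <;> simp_all
  | succ i ih =>
    rw [partSeries_remove _ (le_refl 1), pow_succ' X i, mul_assoc, ← ih]
    have h0 : (fun m : Multiset ℕ => if 1 ∈ m then (0 : R) else
        if m.count 1 = i + 1 then z ^ (m.filter (j < ·)).card else 0) = fun _ => 0 := by
      funext m
      split_ifs with h1 h2
      · rfl
      · rw [Multiset.count_eq_zero_of_notMem h1] at h2
        omega
      · rfl
    rw [h0, partSeries_zero, zero_add, pow_one]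
    congr 2
    funext m
    rw [Multiset.count_cons_self, Multiset.filter_cons_of_neg _ (by omega)]
    simp

/-- The weight `z ^ crank`, with negative powers of `z` replaced by powers of `w`. -/
def crankWeight (z w : R) (m : Multiset ℕ) : R :=
  if m.count 1 = 0 then z ^ m.sup
  else z ^ (m.filter (m.count 1 < ·)).card * w ^ m.count 1

lemma parts_count_le {n : ℕ} (lam : n.Partition) : lam.parts.count 1 ≤ n := by
  have h := Multiset.card_nsmul_le_sum (s := lam.parts) (a := 1) fun _ hx => lam.parts_pos hx
  rw [lam.parts_sum, smul_eq_mul, mul_one] at h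
  exact (Multiset.count_le_card _ _).trans h

/-- Split by the number of ones: the first term has none (the part 1 gets weight 0); the `j`-th
summand has exactly `j + 1`, and `1 - X` removes the freely repeated ones from the unrestricted
series. -/
lemma modX_crankWeight (N : ℕ) (z w : R) :
    modX R N (partSeries (crankWeight z w))
      = modX R N (partSeries (fun m => z ^ m.sup * weight (Function.update (fun _ => 1) 1 0) m))
        + (1 - modX R N X) * ∑ j ∈ Finset.range N, modX R N (C w * X) ^ (j + 1)
          * modX R N (partSeries (weight (fun k => if k ≤ j + 1 then 1 else z))) := by
  have h : modX R N (partSeries (crankWeight z w))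
      = modX R N (partSeries (fun m =>
          z ^ m.sup * weight (Function.update (fun _ => 1) 1 0) m
          + ∑ j ∈ Finset.range N, w ^ (j + 1) *
            if m.count 1 = j + 1 then z ^ (m.filter (j + 1 < ·)).card else 0)) := by
    refine mk_partSeries_congr fun n hn lam => ?_
    have hs := parts_count_le lam
    rw [weight_update, crankWeight]
    by_cases h0 : lam.parts.count 1 = 0
    · rw [if_pos h0, if_neg (Multiset.count_eq_zero.1 h0), Finset.sum_eq_zero]
      · simp [weight]
      · intro j _
        rw [if_neg (by omega), mul_zero]
    · have h1 : 1 ∈ lam.parts := by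
        by_contra h
        exact h0 (Multiset.count_eq_zero_of_notMem h)
      rw [if_neg h0, if_pos h1, mul_zero, zero_add,
        Finset.sum_eq_single (lam.parts.count 1 - 1)]
      · rw [Nat.sub_add_cancel (by omega), if_pos rfl, mul_comm]
      · intro b _ hb
        rw [if_neg (by omega), mul_zero]
      · intro hb
        rw [Finset.mem_range] at hb
        omega
  rw [h, partSeries_add, partSeries_sum, map_add, map_sum]
  congr 1
  rw [Finset.mul_sum]
  refine Finset.sum_congr rfl fun j _ => ?_
  rw [partSeries_const_mul, partSeries_count_one z (by omega)]
  simp only [map_mul, map_pow, map_sub, map_one]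
  ring

/-- The crank series in terms of the `q`-binomial sum. -/
lemma modX_crankWeight_eq (M : ℕ) (z w : R) :
    modX R (M + 1) (partSeries (crankWeight z w) + (C z - 1) * X)
      = (1 - modX R (M + 1) X) * ∑ j ∈ Finset.range (M + 1 + 1), modX R (M + 1) (C w * X) ^ j
          * modX R (M + 1) (partSeries (weight (fun k => if k ≤ j then 1 else z))) := by
  -- The `j = 0` term on the right is Euler's sum times `1 - X`. Its terms for largest part 0 and 1
  -- give (1 - X) + zX, whereas partitions without ones give just 1: hence the correction (z - 1)X,
  -- which matches the convention at n = 1.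
  rw [map_add, modX_crankWeight, modX_partSeries_sup, Finset.sum_range_succ' _ M]
  have h1 : ∀ L, modX R (M + 1) (partSeries (weight
      (fun i => if i ≤ L + 1 then Function.update (fun _ => (1 : R)) 1 0 i else 0)))
      = modX R (M + 1) (partSeries (weight (fun i => if i ≤ L + 1 then 1 else 0)))
        * (1 - modX R (M + 1) X) := by
    intro L
    have := partSeries_weight_update (fun i => if i ≤ L + 1 then (1 : R) else 0) le_rfl
    rw [if_pos (by omega), map_one, one_mul, pow_one] at this
    rw [← map_one (modX R (M + 1)), ← map_sub, ← map_mul, this]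
    congr 3
    funext i
    by_cases hi : i = 1
    · simp [hi]
    · simp [hi]
  have h2 := modX_euler (M + 1) z
  have h3 : modX R (M + 1) (partSeries (weight (fun i => if i ≤ 0 + 1 then 1 else 0)))
      * (1 - modX R (M + 1) X) = 1 := by
    have := partSeries_weight_le_succ (fun _ => (1 : R)) 0
    rw [partSeries_weight_le_zero] at this
    simpa using congrArg (modX R (M + 1)) this
  have h4 : modX R (M + 1) (partSeries (weight fun k => if k ≤ 0 then (1 : R) else z))
      = modX R (M + 1) (partSeries (weight fun _ => z)) := by
    congr 1
    exact partSeries_congr fun n lam => weight_congr lam fun i hi => by rw [if_neg (by omega)]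
  rw [Finset.sum_range_succ', Finset.sum_range_succ', partSeries_weight_le_zero,
    map_one] at h2
  rw [Finset.sum_range_succ' _ (M + 1), h4, ← h2]
  have h5 : ∀ L, Function.update (fun _ => (1 : R)) 1 0 (L + 1 + 1) = 1 := fun L => by simp
  simp only [h1, h5, map_one, mul_one, zero_add, Function.update_self, map_zero, mul_zero,
    zero_mul, add_zero, pow_zero, one_mul, pow_one, mul_add]
  rw [zero_add] at h3
  have h6 : ∑ L ∈ Finset.range M, modX R (M + 1) (C z * X) ^ (L + 1 + 1)
        * (modX R (M + 1) (partSeries (weight (fun i => if i ≤ L + 1 + 1 then 1 else 0)))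
        * (1 - modX R (M + 1) X))
      = (1 - modX R (M + 1) X) * ∑ L ∈ Finset.range M, modX R (M + 1) (C z * X) ^ (L + 1 + 1)
        * modX R (M + 1) (partSeries (weight (fun i => if i ≤ L + 1 + 1 then 1 else 0))) := by
    rw [Finset.mul_sum]
    exact Finset.sum_congr rfl fun _ _ => by ring
  rw [h6]
  simp only [map_mul, map_sub, map_one]
  linear_combination (-modX R (M + 1) (C z) * modX R (M + 1) X) * h3

/-- The Andrews--Garvan product for the crank series. -/
lemma modX_crank_product (M : ℕ) {z w : R} (hzw : z * w = 1) :
    modX R (M + 1) (partSeries (crankWeight z w) + (C z - 1) * X)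
      * ∏ i ∈ Finset.range (M + 1), ((1 - modX R (M + 1) (C z) * modX R (M + 1) X ^ (i + 1))
        * (1 - modX R (M + 1) (C w) * modX R (M + 1) X ^ (i + 1)))
      = ∏ i ∈ Finset.range (M + 1), (1 - modX R (M + 1) X ^ (i + 1)) := by
  set q := modX R (M + 1) X with hqdef
  have hq : q ^ (M + 1 + 1) = 0 := modX_X_pow (M + 1)
  set t : ℕ → _ := fun j => modX R (M + 1) (partSeries (weight (fun k => if k ≤ j then 1 else z)))
    with ht
  have h0 : t 0 * ∏ i ∈ Finset.range (M + 1), (1 - modX R (M + 1) (C z) * q ^ (i + 1)) = 1 :=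
    modX_partSeries_weight_prod (fun k => if k ≤ 0 then (1 : R) else z) (M + 1)
  have hstep : ∀ j, t (j + 1) * (1 - q ^ (j + 1))
      = t j * (1 - modX R (M + 1) (C z) * q ^ (j + 1)) := by
    intro j
    have e1 := partSeries_weight_update (fun k => if k ≤ j + 1 then (1 : R) else z)
      (a := j + 1) (by omega)
    have e2 := partSeries_weight_update (fun k => if k ≤ j then (1 : R) else z)
      (a := j + 1) (by omega)
    have e3 : Function.update (fun k => if k ≤ j + 1 then (1 : R) else z) (j + 1) 0
        = Function.update (fun k => if k ≤ j then (1 : R) else z) (j + 1) 0 := by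
      funext i
      rcases lt_trichotomy i (j + 1) with h | rfl | h
      · simp only [Function.update_of_ne h.ne]
        rw [if_pos (by omega), if_pos (by omega)]
      · simp
      · simp only [Function.update_of_ne h.ne']
        rw [if_neg (by omega), if_neg (by omega)]
    rw [e3, ← e2] at e1
    have e4 := congrArg (modX R (M + 1)) e1
    simpa [ht, hqdef] using e4
  -- Take `a = zq` and `y = w`, so that `a * y = q` since zw = 1; the product in front of `t j`
  -- normalises the zeroth coefficient to 1.
  have hb := qbinomial hq (modX R (M + 1) (C z) * q) (modX R (M + 1) (C w))
    (fun j => (∏ i ∈ Finset.range (M + 1), (1 - modX R (M + 1) (C z) * q ^ (i + 1))) * t j)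
    (by rw [mul_comm, h0]) (fun j => by
      linear_combination (∏ i ∈ Finset.range (M + 1), (1 - modX R (M + 1) (C z) * q ^ (i + 1)))
        * hstep j)
  have hzw' : modX R (M + 1) (C z) * modX R (M + 1) (C w) = 1 := by
    rw [← map_mul, ← map_mul, hzw, map_one, map_one]
  have hc : ∀ i, 1 - modX R (M + 1) (C z) * q * modX R (M + 1) (C w) * q ^ (i + 1)
      = 1 - q ^ (i + 1 + 1) := fun i => by linear_combination (- q ^ (i + 2)) * hzw'
  simp only [hc] at hb
  -- The shifted product has one surplus factor, `1 - q ^ (M + 2)`, equal to 1 in the quotient.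
  have hd : (1 - q) * ∏ i ∈ Finset.range (M + 1), (1 - q ^ (i + 1 + 1))
      = ∏ i ∈ Finset.range (M + 1), (1 - q ^ (i + 1)) := by
    have e1 := Finset.prod_range_succ' (fun i => 1 - q ^ (i + 1)) (M + 1)
    have e2 := Finset.prod_range_succ (fun i => 1 - q ^ (i + 1)) (M + 1)
    rw [hq, sub_zero, mul_one] at e2
    rw [← e2, e1, zero_add, pow_one, mul_comm]
  rw [modX_crankWeight_eq, ← hd, ← hb, Finset.prod_mul_distrib]
  have he : ∑ j ∈ Finset.range (M + 1 + 1),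
      (∏ i ∈ Finset.range (M + 1), (1 - modX R (M + 1) (C z) * q ^ (i + 1))) * t j
        * (modX R (M + 1) (C w) * q) ^ j
      = (∏ i ∈ Finset.range (M + 1), (1 - modX R (M + 1) (C z) * q ^ (i + 1)))
        * ∑ j ∈ Finset.range (M + 1 + 1), modX R (M + 1) (C w * X) ^ j * t j := by
    rw [Finset.mul_sum]
    exact Finset.sum_congr rfl fun _ _ => by rw [map_mul]; ring
  rw [he]
  ring

end Truncated

/-! ### The crank series to second order at z = 1 -/

section SecondOrder

variable {R : Type*} [CommRing R]

lemma prod_one_sub_mul_of_sq_zero {S ι : Type*} [CommRing S] {σ : S} (hσ : σ * σ = 0)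
    (s : Finset ι) (f : ι → S) : ∏ i ∈ s, (1 - σ * f i) = 1 - σ * ∑ i ∈ s, f i := by
  classical
  induction s using Finset.induction_on with
  | empty => simp
  | insert a s ha ih =>
    rw [Finset.prod_insert ha, Finset.sum_insert ha, ih]
    linear_combination f a * (∑ i ∈ s, f i) * hσ

lemma one_sub_mul_geom {S : Type*} [CommRing S] {N : ℕ} {x : S} (hx : x ^ (N + 1) = 0) :
    (1 - x) * ∑ k ∈ Finset.range N, x ^ (k + 1) = x := by
  have h : ∀ K, (1 - x) * ∑ k ∈ Finset.range K, x ^ (k + 1) = x - x ^ (K + 1) := by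
    intro K
    induction K with
    | zero => simp
    | succ K ih => rw [Finset.sum_range_succ, mul_add, ih]; ring
  rw [h, hx, sub_zero]

/-- Together with `one_sub_mul_geom` this is ∑ k xᵏ = x/(1 - x)² for nilpotent `x`. -/
lemma one_sub_mul_geom_deriv {S : Type*} [CommRing S] {N : ℕ} {x : S} (hx : x ^ (N + 1) = 0) :
    (1 - x) * ∑ k ∈ Finset.range N, ((k + 1 : ℕ) : S) * x ^ (k + 1)
      = ∑ k ∈ Finset.range N, x ^ (k + 1) := by
  have h : ∀ K, (1 - x) * ∑ k ∈ Finset.range K, ((k + 1 : ℕ) : S) * x ^ (k + 1)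
      = ∑ k ∈ Finset.range K, x ^ (k + 1) - (K : S) * x ^ (K + 1) := by
    intro K
    induction K with
    | zero => simp
    | succ K ih =>
      rw [Finset.sum_range_succ, mul_add, ih, Finset.sum_range_succ]
      push_cast
      ring
  rw [h, hx, mul_zero, sub_zero]

lemma partSeries_count {a : ℕ} (ha : 1 ≤ a) :
    partSeries (fun m => (m.count a : R)) * (1 - X ^ a) = X ^ a * partSeries (fun _ => 1) := by
  have h := partSeries_remove (fun m => (m.count a : R)) ha
  have h0 : (fun m : Multiset ℕ => if a ∈ m then (0 : R) else (m.count a : R)) = fun _ => 0 := by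
    funext m
    split_ifs with hm
    · rfl
    · rw [Multiset.count_eq_zero_of_notMem hm, Nat.cast_zero]
  have h1 : (fun m : Multiset ℕ => ((a ::ₘ m).count a : R)) = fun m => (m.count a : R) + 1 := by
    funext m
    rw [Multiset.count_cons_self]
    push_cast
    rfl
  rw [h0, h1, partSeries_zero, partSeries_add] at h
  linear_combination h

lemma sum_parts_eq_sum_count {n N : ℕ} (hn : n ≤ N) (lam : n.Partition) :
    lam.parts.sum = ∑ a ∈ Finset.range N, (a + 1) * lam.parts.count (a + 1) := by
  refine Eq.trans ?_ (Finset.sum_map (Finset.range N) (addRightEmbedding 1)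
    (fun a => a * lam.parts.count a))
  rw [Finset.sum_multiset_count]
  simp only [smul_eq_mul, mul_comm]
  refine Finset.sum_subset (fun a ha => ?_) fun a _ ha => ?_
  · rw [Multiset.mem_toFinset] at ha
    have h1 := lam.parts_pos ha
    have h2 := lam.le_of_mem_parts ha
    simp only [Finset.mem_map, Finset.mem_range, addRightEmbedding_apply]
    exact ⟨a - 1, by omega, by omega⟩
  · rw [Multiset.mem_toFinset] at ha
    rw [Multiset.count_eq_zero_of_notMem ha, mul_zero]

lemma modX_X_pow_pow (N a : ℕ) : ((modX R N X) ^ (a + 1)) ^ (N + 1) = 0 := by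
  rw [← pow_mul, mul_comm, pow_mul, modX_X_pow, zero_pow (by omega)]

/-- `∑ n p(n) qⁿ = (∑ p(n) qⁿ) ∑ₐ qᵃ / (1 - qᵃ)²`. -/
lemma modX_partSeries_sum (N : ℕ) :
    modX R N (partSeries (fun m => (m.sum : R)))
      = modX R N (partSeries (fun _ => 1)) * ∑ a ∈ Finset.range N, ∑ k ∈ Finset.range N,
          ((k + 1 : ℕ) : R⟦X⟧ ⧸ Ideal.span {(X : R⟦X⟧) ^ (N + 1)})
            * ((modX R N X) ^ (a + 1)) ^ (k + 1) := by
  have h : modX R N (partSeries (fun m => (m.sum : R)))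
      = modX R N (partSeries (fun m => ∑ a ∈ Finset.range N,
          ((a + 1 : ℕ) : R) * (m.count (a + 1) : R))) := by
    refine mk_partSeries_congr fun n hn lam => ?_
    rw [sum_parts_eq_sum_count hn]
    push_cast
    rfl
  -- Counting parts by size yields the Lambert series ∑ a qᵃ/(1 - qᵃ); exchanging the double sum
  -- turns it into ∑ qᵃ/(1 - qᵃ)².
  rw [h, partSeries_sum, map_sum, Finset.sum_comm, Finset.mul_sum]
  refine Finset.sum_congr rfl fun a _ => ?_
  rw [partSeries_const_mul, map_mul, ← Finset.mul_sum, map_natCast, map_natCast]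
  have h1 := congrArg (modX R N) (partSeries_count (R := R) (a := a + 1) (by omega))
  simp only [map_mul, map_sub, map_one, map_pow] at h1
  have h2 := one_sub_mul_geom (modX_X_pow_pow (R := R) N a)
  have h3 : ∑ k ∈ Finset.range N, ((modX R N X) ^ (k + 1)) ^ (a + 1)
      = ∑ k ∈ Finset.range N, ((modX R N X) ^ (a + 1)) ^ (k + 1) :=
    Finset.sum_congr rfl fun k _ => by rw [← pow_mul, ← pow_mul, mul_comm]
  rw [h3]
  set g := ∑ k ∈ Finset.range N, ((modX R N X) ^ (a + 1)) ^ (k + 1)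
  set s := modX R N (partSeries fun m => (m.count (a + 1) : R))
  set p := modX R N (partSeries fun _ => (1 : R))
  linear_combination ((a + 1 : ℕ) : R⟦X⟧ ⧸ Ideal.span {(X : R⟦X⟧) ^ (N + 1)})
    * ((1 + g) * h1 - (p + s) * h2)

/-- The crank generating function to second order at `z = 1`. -/
theorem sum_crankWeight {z w : R} (hzw : z * w = 1) (hs : (z + w - 2) * (z + w - 2) = 0) {n : ℕ}
    (hn : n ≠ 1) :
    ∑ lam : n.Partition, crankWeight z w lam.parts
      = (1 + (z + w - 2) * n) * Fintype.card n.Partition := by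
  have hK := modX_crank_product n hzw
  have hP := modX_partSeries_weight_prod (fun _ => (1 : R)) (n + 1)
  have hD := modX_partSeries_sum (R := R) (n + 1)
  have hq := modX_X_pow_pow (R := R) (n + 1)
  have hzw' : modX R (n + 1) (C z) * modX R (n + 1) (C w) = 1 := by
    rw [← map_mul, ← map_mul, hzw, map_one, map_one]
  have hσ : modX R (n + 1) (C (z + w - 2)) * modX R (n + 1) (C (z + w - 2)) = 0 := by
    rw [← map_mul, ← map_mul, hs, map_zero, map_zero]
  have hσ' : modX R (n + 1) (C (z + w - 2))
      = modX R (n + 1) (C z) + modX R (n + 1) (C w) - 2 := by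
    simp only [map_sub, map_add, map_ofNat]
  have hw1 : partSeries (weight fun _ => (1 : R)) = partSeries fun _ => 1 := by
    congr 1
    funext m
    simp [weight]
  simp only [map_one, one_mul, hw1] at hP
  have hfac : ∀ i, (1 - modX R (n + 1) (C z) * modX R (n + 1) X ^ (i + 1))
        * (1 - modX R (n + 1) (C w) * modX R (n + 1) X ^ (i + 1))
      = (1 - modX R (n + 1) X ^ (i + 1)) * (1 - modX R (n + 1) X ^ (i + 1))
        * (1 - modX R (n + 1) (C (z + w - 2)) * ∑ k ∈ Finset.range (n + 1),
          ((k + 1 : ℕ) : R⟦X⟧ ⧸ Ideal.span {(X : R⟦X⟧) ^ (n + 1 + 1)})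
            * ((modX R (n + 1) X) ^ (i + 1)) ^ (k + 1)) := by
    intro i
    have h1 := one_sub_mul_geom (hq i)
    have h2 := one_sub_mul_geom_deriv (hq i)
    set g := ∑ k ∈ Finset.range (n + 1), ((modX R (n + 1) X) ^ (i + 1)) ^ (k + 1)
    set h := ∑ k ∈ Finset.range (n + 1),
      ((k + 1 : ℕ) : R⟦X⟧ ⧸ Ideal.span {(X : R⟦X⟧) ^ (n + 1 + 1)})
        * ((modX R (n + 1) X) ^ (i + 1)) ^ (k + 1)
    rw [hσ']
    linear_combination (modX R (n + 1) X ^ (i + 1)) ^ 2 * hzw'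
      + (modX R (n + 1) (C z) + modX R (n + 1) (C w) - 2)
        * (h1 + (1 - modX R (n + 1) X ^ (i + 1)) * h2)
  rw [Finset.prod_congr rfl fun i _ => hfac i, Finset.prod_mul_distrib, Finset.prod_mul_distrib,
    prod_one_sub_mul_of_sq_zero hσ] at hK
  have key : modX R (n + 1) (partSeries (crankWeight z w) + (C z - 1) * X)
      = modX R (n + 1) (partSeries (fun _ => 1)
        + C (z + w - 2) * partSeries (fun m => (m.sum : R))) := by
    rw [map_add _ (partSeries fun _ => (1 : R)), map_mul, hD]
    set K := modX R (n + 1) (partSeries (crankWeight z w) + (C z - 1) * X)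
    set E := ∏ i ∈ Finset.range (n + 1), (1 - modX R (n + 1) X ^ (i + 1))
    set P := modX R (n + 1) (partSeries fun _ => (1 : R))
    set σ := modX R (n + 1) (C (z + w - 2))
    set T := ∑ i ∈ Finset.range (n + 1), ∑ k ∈ Finset.range (n + 1),
      ((k + 1 : ℕ) : R⟦X⟧ ⧸ Ideal.span {(X : R⟦X⟧) ^ (n + 1 + 1)})
        * ((modX R (n + 1) X) ^ (i + 1)) ^ (k + 1)
    -- The product formula reads K·E²(1 - σT) = E, and P is the inverse of E.
    have h1 : K * (1 - σ * T) = P := by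
      linear_combination P ^ 2 * hK - (K * (1 - σ * T) * (P * E + 1) - P) * hP
    linear_combination (1 + σ * T) * h1 + K * T ^ 2 * hσ
  have hc := coeff_eq_of_mk_eq key (n := n) (by omega)
  rw [map_add, map_add, coeff_C_mul, coeff_partSeries, coeff_partSeries, coeff_partSeries] at hc
  -- The correction term lives only in degree 1, excluded by `hn`.
  have hX : coeff n ((C z - 1) * (X : R⟦X⟧)) = 0 := by
    rw [← map_one C, ← map_sub, coeff_C_mul, coeff_X, if_neg hn, mul_zero]
  rw [hX, add_zero] at hc
  rw [hc]
  simp only [Nat.Partition.parts_sum, Finset.sum_const, Finset.card_univ, nsmul_eq_mul]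
  ring

end SecondOrder

/-! ### Second moments via doubly dual numbers -/

section Moments

open TrivSqZeroExt

/-- The infinitesimal `ε₁` of the inner ring of dual numbers. -/
def innerEps : DualNumber (DualNumber ℤ) := inl (DualNumber.eps : DualNumber ℤ)

lemma innerEps_mul_innerEps : innerEps * innerEps = 0 := by
  rw [innerEps, ← inl_mul, DualNumber.eps_mul_eps, inl_zero]

/-- The infinitesimal `ε₂` of the outer ring of dual numbers. -/
def outerEps : DualNumber (DualNumber ℤ) := DualNumber.eps

lemma outerEps_mul_outerEps : outerEps * outerEps = 0 := DualNumber.eps_mul_eps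

/-- The character `k ↦ (1 + kε₁)(1 + kε₂)` of `ℤ`, whose `ε₁ε₂`-coefficient is `k²`. -/
def dualChar (k : ℤ) : DualNumber (DualNumber ℤ) :=
  (1 + k * innerEps) * (1 + k * outerEps)

lemma dualChar_add (a b : ℤ) : dualChar (a + b) = dualChar a * dualChar b := by
  unfold dualChar
  push_cast
  linear_combination
    (-(a * b : DualNumber (DualNumber ℤ)) * (1 + a * outerEps) * (1 + b * outerEps))
      * innerEps_mul_innerEps
    - (a * b : DualNumber (DualNumber ℤ)) * (1 + (a + b) * innerEps) * outerEps_mul_outerEps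

lemma dualChar_zero : dualChar 0 = 1 := by simp [dualChar]

lemma dualChar_one_pow (k : ℕ) : dualChar 1 ^ k = dualChar k := by
  induction k with
  | zero => simp [dualChar_zero]
  | succ k ih => rw [pow_succ, ih, ← dualChar_add]; simp

lemma dualChar_neg_one_pow (k : ℕ) : dualChar (-1) ^ k = dualChar (-k) := by
  induction k with
  | zero => simp [dualChar_zero]
  | succ k ih =>
    rw [pow_succ, ih, ← dualChar_add]
    congr 1
    push_cast
    ring

lemma dualChar_snd_snd (k : ℤ) : (dualChar k).snd.snd = k ^ 2 := by
  simp [dualChar, pow_two, innerEps, outerEps]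

/-- The `ε₁ε₂`-coefficient as an additive map. -/
def topCoeff : DualNumber (DualNumber ℤ) →+ ℤ where
  toFun x := x.snd.snd
  map_zero' := rfl
  map_add' _ _ := rfl

lemma topCoeff_dualChar (k : ℤ) : topCoeff (dualChar k) = k ^ 2 := dualChar_snd_snd k

lemma crankWeight_dualChar {n : ℕ} (lam : n.Partition) :
    crankWeight (dualChar 1) (dualChar (-1)) lam.parts = dualChar (crank lam) := by
  unfold crankWeight crank numPartsAboveOnes largestPart numOnes
  split_ifs with h
  · exact dualChar_one_pow _
  · rw [dualChar_one_pow, dualChar_neg_one_pow, ← dualChar_add, sub_eq_add_neg]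

/-- The right side squares to zero, which makes the second-order expansion `sum_crankWeight`
applicable. -/
lemma dualChar_second_difference :
    dualChar 1 + dualChar (-1) - 2 = 2 * (innerEps * outerEps) := by
  simp only [dualChar]
  push_cast
  ring

lemma topCoeff_nat (k : ℕ) : topCoeff (k : DualNumber (DualNumber ℤ)) = 0 := by
  change (k : DualNumber (DualNumber ℤ)).snd.snd = 0
  simp

lemma topCoeff_eps_mul_eps : topCoeff (innerEps * outerEps) = 1 := by
  change (innerEps * outerEps).snd.snd = 1
  simp [innerEps, outerEps]

theorem sum_crank_sq {n : ℕ} (hn : n ≠ 1) :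
    ∑ lam : n.Partition, crank lam ^ 2 = 2 * n * Fintype.card n.Partition := by
  have h := sum_crankWeight (z := dualChar 1) (w := dualChar (-1))
    (by rw [← dualChar_add]; simp [dualChar_zero])
    (by
        rw [dualChar_second_difference]
        linear_combination 4 * innerEps ^ 2 * outerEps_mul_outerEps) hn
  simp only [crankWeight_dualChar, dualChar_second_difference] at h
  have h3 := congrArg topCoeff h
  rw [map_sum] at h3
  simp only [topCoeff_dualChar] at h3
  have h4 : (1 + 2 * (innerEps * outerEps) * (n : DualNumber (DualNumber ℤ)))
        * (Fintype.card n.Partition : DualNumber (DualNumber ℤ))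
      = (Fintype.card n.Partition : DualNumber (DualNumber ℤ))
        + (2 * n * Fintype.card n.Partition) • (innerEps * outerEps) := by
    rw [nsmul_eq_mul]
    push_cast
    ring
  rw [h3, h4, map_add, topCoeff_nat, map_nsmul, topCoeff_eps_mul_eps]
  simp

theorem sum_largestPart_sq (n : ℕ) :
    ∑ lam : n.Partition, (largestPart lam : ℤ) ^ 2
      = ∑ lam : n.Partition, (numParts lam : ℤ) ^ 2 := by
  have h := congrArg topCoeff (sum_pow_sup_eq_sum_pow_card n (dualChar 1))
  rw [map_sum, map_sum] at h
  simpa only [dualChar_one_pow, topCoeff_dualChar, largestPart, numParts] using h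

/-- Second moments of a statistic as sums over partitions. -/
lemma finsum_sq_mul_card {n : ℕ} (f : n.Partition → ℤ) :
    ∑ᶠ m : ℤ, m ^ 2 * ((Finset.univ.filter (fun lam => f lam = m)).card : ℤ)
      = ∑ lam, f lam ^ 2 := by
  rw [Finset.sum_comp (fun m : ℤ => m ^ 2) f, finsum_eq_sum_of_support_subset
    (s := Finset.univ.image f)]
  · exact Finset.sum_congr rfl fun m _ => by rw [nsmul_eq_mul, mul_comm]
  · intro m hm
    by_contra h
    apply hm
    have : Finset.univ.filter (fun lam => f lam = m) = ∅ := by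
      rw [Finset.filter_eq_empty_iff]
      intro lam _ hl
      exact h (by simpa using ⟨lam, hl⟩)
    simp [this]

lemma N2_eq (n : ℕ) : N2 n = ∑ lam : n.Partition, rank lam ^ 2 :=
  finsum_sq_mul_card rank

lemma p2_eq (n : ℕ) : (p2 n : ℤ) = ∑ lam : n.Partition, (numParts lam : ℤ) ^ 2 := by
  have h : p2 n = ∑ lam : n.Partition, numParts lam ^ 2 := by
    unfold p2 partsCount
    rw [Finset.sum_comp (fun m : ℕ => m ^ 2) (numParts (n := n)), finsum_eq_sum_of_support_subset
      (s := Finset.univ.image (numParts (n := n)))]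
    · exact Finset.sum_congr rfl fun m _ => by rw [smul_eq_mul, mul_comm]
    · intro m hm
      by_contra h
      apply hm
      have : Finset.univ.filter (fun lam : n.Partition => numParts lam = m) = ∅ := by
        rw [Finset.filter_eq_empty_iff]
        intro lam _ hl
        exact h (by simpa using ⟨lam, hl⟩)
      simp [this]
  rw [h]
  push_cast
  rfl

/-- Dyson's identity `M₂(n) = 2 n p(n)`. -/
theorem M2_eq (n : ℕ) : M2 n = 2 * n * Fintype.card n.Partition := by
  by_cases hn : n = 1
  · subst hn
    have h : M2 1 = ∑ m ∈ ({1, -1} : Finset ℤ), m ^ 2 * crankCount m 1 := by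
      refine finsum_eq_sum_of_support_subset _ fun m hm => ?_
      by_contra h
      apply hm
      simp only [Finset.coe_insert, Finset.coe_singleton, Set.mem_insert_iff,
        Set.mem_singleton_iff] at h
      by_cases h0 : m = 0 <;> simp [crankCount, h0, h]
    rw [h, Fintype.card_unique]
    simp [crankCount]
  · rw [← sum_crank_sq hn, ← finsum_sq_mul_card]
    unfold M2 crankCount
    simp only [if_neg hn]

lemma le_largestPart_mul_numParts {n : ℕ} (lam : n.Partition) :
    n ≤ largestPart lam * numParts lam := by
  have h := Multiset.sum_le_card_nsmul lam.parts lam.parts.sup fun _ hx => Multiset.le_sup hx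
  rwa [lam.parts_sum, smul_eq_mul, mul_comm] at h

end Moments

end PartitionMoments

/-! ### The inequality -/

open PartitionMoments in
theorem theorem1p2 (n : ℕ) :
    PartitionMoments.M2 n + PartitionMoments.N2 n ≤ 2 * (PartitionMoments.p2 n : ℤ) := by
  have h1 : ∑ lam : n.Partition, rank lam ^ 2 = 2 * ∑ lam : n.Partition, (numParts lam : ℤ) ^ 2
      - 2 * ∑ lam : n.Partition, (largestPart lam * numParts lam : ℤ) := by
    rw [two_mul (∑ lam : n.Partition, (numParts lam : ℤ) ^ 2)]
    -- Trading one of the two copies of ∑k² for ∑ℓ² leaves ∑(ℓ² + k² - 2ℓk), the sum of squared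
    -- ranks.
    nth_rw 1 [← sum_largestPart_sq]
    rw [Finset.mul_sum, ← Finset.sum_add_distrib, ← Finset.sum_sub_distrib]
    exact Finset.sum_congr rfl fun lam _ => by rw [rank]; ring
  have h2 : (n : ℤ) * Fintype.card n.Partition
      ≤ ∑ lam : n.Partition, (largestPart lam * numParts lam : ℤ) := by
    rw [mul_comm, ← nsmul_eq_mul]
    exact Finset.card_nsmul_le_sum _ _ _ fun lam _ => by
      exact_mod_cast le_largestPart_mul_numParts lam
  rw [M2_eq, N2_eq, p2_eq, h1]
  linarith
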